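/- Let $n \geq 1$. Let $\{F_i\}_{i\ge 0}$ and $\{G_i\}_{i \geq 0}$ be variables. There exists a power series \[ \operatorname{Res}_n \in \mathbf{Z}\bigl[F_n,F_n^{-1},\{F_k\}_{k \geq n+1},\{G_k\}_{k \geq 0}\bigr][[F_0,\dots,F_{n-1}]] \] with the following property. Let $p$ be a prime number and let $K$ be a finite extension of $\mathbf{Q}_p$, or more generally a finite totally ramified extension of $W(k)[1/p]$, where $k$ is a perfect field of characteristic $p$. Let $\mathcal{O}_K$ be the ring of integers of $K$, let $\mathbf{C}_p$ be the completion of an algebraic closure of $K$, and let $\mathfrak{m}_{\mathbf{C}_p} = \{z \in \mathbf{C}_p : |z| < 1\}$. Let $f(X) = \sum_{i \ge 0} f_i X^i$ and $g(X) = \sum_{i \ge 0} g_i X^i$ be elements of $\mathcal{O}_K[[X]]$ such that $f$ has Weierstrass degree $n$, i.e. $n$ is the smallest integer with $f_n \in \mathcal{O}_K^\times$. Then $f$ has finitely many roots in $\mathfrak{m}_{\mathbf{C}_p}$, the series obtained from $\operatorname{Res}_n$ by substituting $F_i = f_i$ and $G_i = g_i$ converges in $\mathcal{O}_K$, and its sum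 $\operatorname{Res}_n(f,g)$ satisfies \[ \prod_{\substack{z \in \mathfrak{m}_{\mathbf{C}_p} \\ f(z)=0}} g(z) = \operatorname{Res}_n(f,g), \] where the roots $z$ of $f$ are counted with multiplicity. In particular, $\operatorname{Res}_n(f,g)=0$ if and only if $f$ and $g$ have a common root in $\mathfrak{m}_{\mathbf{C}_p}$. -/

import Mathlib

noncomputable section

namespace PadicResultant

open PowerSeries

/-! ### Fields, integers, and the completed algebraic closure -/

/-- The ring of integers `{x ∈ K : ‖x‖ ≤ 1}` of a nonarchimedean normed field `K`. -/
abbrev integers (K : Type*) [NormedField K] [IsUltrametricDist K] : ValuationSubring K :=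
  (NormedField.valuation (K := K)).valuationSubring

/-- A `p`-adic field: a field of characteristic zero, complete for a nontrivial nonarchimedean
absolute value (normalized in any way), whose ring of integers is a discrete valuation ring with perfect residue field of
characteristic `p`. Equivalently, a finite totally ramified extension of `W(k)[1/p]` for a perfect
field `k` of characteristic `p`; when `k` is finite, these are the finite extensions of `ℚ_p`. -/
class IsPadicField (p : ℕ) (K : Type*) [NontriviallyNormedField K] [IsUltrametricDist K]
    [CompleteSpace K] : Prop where
  charZero : CharZero K
  dvr : IsDiscreteValuationRing (integers K)
  residue_char : CharP (IsLocalRing.ResidueField (integers K)) p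
  residue_perfect : PerfectField (IsLocalRing.ResidueField (integers K))

/-- An algebraic closure of `K`, to be normed by the unique extension of the absolute value. -/
def AlgCl (K : Type*) [Field K] : Type _ := AlgebraicClosure K

section

variable (K : Type*) [NontriviallyNormedField K] [IsUltrametricDist K] [CompleteSpace K]

/-- The spectral norm: the unique absolute value on the algebraic closure extending that of `K`. -/
instance : NontriviallyNormedField (AlgCl K) :=
  spectralNorm.nontriviallyNormedField K (AlgebraicClosure K)

instance : NormedAlgebra K (AlgCl K) := spectralNorm.normedAlgebra K (AlgebraicClosure K)

/-- The completion of an algebraic closure of `K` (the field `ℂ_p` when `K` is `p`-adic). -/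
abbrev Cp : Type _ := UniformSpace.Completion (AlgCl K)

instance : NontriviallyNormedField (Cp K) where
  non_trivial := by
    obtain ⟨x, hx⟩ := NontriviallyNormedField.non_trivial (α := AlgCl K)
    exact ⟨(x : Cp K), by rwa [UniformSpace.Completion.norm_coe]⟩

variable {K}

/-- The value `f(z) = ∑ fᵢ zⁱ` in `ℂ_p`; the series converges whenever `‖z‖ < 1`. -/
def eval (f : (integers K)⟦X⟧) (z : Cp K) : Cp K :=
  ∑' i : ℕ, algebraMap K (Cp K) ((coeff i f : integers K) : K) * z ^ i

/-- The set of roots of `f` in the open unit disk of `ℂ_p`. -/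
def diskRoots (f : (integers K)⟦X⟧) : Set (Cp K) := {z | ‖z‖ < 1 ∧ eval f z = 0}

/-- The multiplicity of `z` as a root of `f`: the order of vanishing at `z` of the analytic
function defined by `f` on the open unit disk. -/
def rootMult (f : (integers K)⟦X⟧) (z : Cp K) : ℕ := analyticOrderNatAt (eval f) z

end

/-! ### Weierstrass degree -/

/-- The Weierstrass degree: the smallest `n` such that the coefficient of `Xⁿ` is a unit, and `⊤`
if there is none. -/
def wideg {A : Type*} [CommRing A] (f : A⟦X⟧) : ℕ∞ :=
  sInf {m : ℕ∞ | ∃ i : ℕ, m = i ∧ IsUnit (coeff i f)}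

theorem isUnit_coeff_of_wideg {A : Type*} [CommRing A] {f : A⟦X⟧} {n : ℕ} (h : wideg f = n) :
    IsUnit (coeff n f) := by
  have hne : {m : ℕ∞ | ∃ i : ℕ, m = i ∧ IsUnit (coeff i f)}.Nonempty := by
    by_contra hc
    rw [Set.not_nonempty_iff_eq_empty] at hc
    rw [wideg, hc, sInf_empty] at h
    exact ENat.top_ne_natCast n h
  obtain ⟨i, hi, hu⟩ := csInf_mem hne
  have hin : (n : ℕ∞) = i := h.symm.trans hi
  rwa [Nat.cast_inj.mp hin]

/-! ### The ring of universal power series and specialization -/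

/-- The variables `F_k` for `k ≥ n` (left) and `G_k` for `k ≥ 0` (right). -/
abbrev Vars (n : ℕ) : Type := {k : ℕ // n ≤ k} ⊕ ℕ

/-- The ring `ℤ[F_n, F_n⁻¹, {F_k}_{k > n}, {G_k}_{k ≥ 0}]`. -/
abbrev CoeffRing (n : ℕ) : Type :=
  Localization.Away (MvPolynomial.X (Sum.inl ⟨n, le_rfl⟩) : MvPolynomial (Vars n) ℤ)

/-- The ring `ℤ[F_n, F_n⁻¹, {F_k}_{k > n}, {G_k}_{k ≥ 0}]⟦F_0, …, F_{n-1}⟧`. -/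
abbrev UnivRing (n : ℕ) : Type := MvPowerSeries (Fin n) (CoeffRing n)

section

variable {A : Type*} [CommRing A] {n : ℕ}

/-- The ring homomorphism `F_k ↦ f_k` (`k ≥ n`), `G_k ↦ g_k`, where `f_n` is a unit. -/
def specialize (f g : A⟦X⟧) (hf : IsUnit (coeff n f)) : CoeffRing n →+* A :=
  Localization.awayLift
    (MvPolynomial.eval₂Hom (Int.castRingHom A)
      (Sum.elim (fun k : {k : ℕ // n ≤ k} => coeff (k : ℕ) f) (fun k : ℕ => coeff k g)))
    (MvPolynomial.X (Sum.inl ⟨n, le_rfl⟩)) (by simpa using hf)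

/-- The specialization at `F_k ↦ f_k`, `G_k ↦ g_k` of the term of multidegree `d` of the power
series `R` in `F_0, …, F_{n-1}`. -/
def specializedTerm (R : UnivRing n) (f g : A⟦X⟧) (hf : IsUnit (coeff n f)) (d : Fin n →₀ ℕ) : A :=
  specialize f g hf (MvPowerSeries.coeff d R) * ∏ i : Fin n, coeff (i : ℕ) f ^ d i

end

end PadicResultant

end

/-! The universal ring is complete for the ideal $(F_0,\dots,F_{n-1})$ and $F_n$ is a unit, so
Weierstrass division by $F=\sum F_iX^i$ is possible there (`exists_universal_division`): $X^n = Fq +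
r$ and $G = Fq' + s$ with $\deg r, \deg s < n$. The series $\operatorname{Res}_n$ is the resultant
of $X^n - r$ and $s$. Since $f_0,\dots,f_{n-1}$ are topologically nilpotent, specialization extends
to a ring homomorphism on the universal ring whose values are the sums of the specialized series
(`exists_specializeHom`). It carries both divisions to $\mathcal{O}_K$. There $q$ is a unit, so $P =
X^n - r = fq$ has the same roots in the open disk as $f$, with the same multiplicities; all roots of
$P$ lie in that disk, and $g = s$ at each of them. The product formula for the resultant of a split
monic polynomial then concludes (`finprod_eval_eq_resultant`). -/

noncomputable section

namespace PadicResultant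

open PowerSeries

/-! ### The ring of integers as a linearly topologized ring -/

section Integers

variable {K : Type*} [NormedField K] [IsUltrametricDist K]

theorem norm_integers_le_one (x : integers K) : ‖(x : K)‖ ≤ 1 := x.2

theorem isUnit_integers_iff {x : integers K} : IsUnit x ↔ ‖(x : K)‖ = 1 := by
  constructor
  · intro h
    obtain ⟨y, hy⟩ := h.exists_right_inv
    refine le_antisymm (norm_integers_le_one x) ?_
    have hxy : ‖(x : K)‖ * ‖(y : K)‖ = 1 := by
      rw [← norm_mul, ← MulMemClass.coe_mul, hy, OneMemClass.coe_one, norm_one]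
    rw [← hxy]
    exact mul_le_of_le_one_right (norm_nonneg _) (norm_integers_le_one y)
  · intro h
    have hx : (x : K) ≠ 0 := norm_ne_zero_iff.1 (by simp [h])
    have hmem : ‖(x : K)⁻¹‖ ≤ 1 := by rw [norm_inv, h, inv_one]
    exact .of_mul_eq_one ⟨(x : K)⁻¹, hmem⟩ (Subtype.ext (mul_inv_cancel₀ hx))

theorem norm_lt_one_of_not_isUnit {x : integers K} (hx : ¬ IsUnit x) : ‖(x : K)‖ < 1 :=
  lt_of_le_of_ne (norm_integers_le_one x) fun h ↦ hx (isUnit_integers_iff.2 h)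

instance completeSpace_integers [CompleteSpace K] : CompleteSpace (integers K) := by
  have h : IsClosed {x : K | ‖x‖ ≤ 1} := isClosed_le continuous_norm continuous_const
  exact h.completeSpace_coe

/-- The ideal of integers of norm less than `ε`. -/
def ballIdeal (K : Type*) [NormedField K] [IsUltrametricDist K] (ε : ℝ) (hε : 0 < ε) :
    Ideal (integers K) where
  carrier := {x | ‖(x : K)‖ < ε}
  add_mem' {x y} hx hy := by
    simp only [Set.mem_ofPred_eq] at *
    push_cast
    exact (IsUltrametricDist.norm_add_le_max _ _).trans_lt (max_lt hx hy)
  zero_mem' := by simpa using hε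
  smul_mem' c x hx := by
    simp only [Set.mem_ofPred_eq, smul_eq_mul] at *
    push_cast
    rw [norm_mul]
    exact (mul_le_of_le_one_left (norm_nonneg _) (norm_integers_le_one c)).trans_lt hx

/-- Evaluation of multivariate power series with values in the integers needs a topology with a
basis of ideals at zero. -/
instance isLinearTopology_integers : IsLinearTopology (integers K) (integers K) := by
  refine IsLinearTopology.mk_of_hasBasis (ι := {ε : ℝ // 0 < ε}) (p := fun _ ↦ True)
    (s := fun ε ↦ ballIdeal K ε.1 ε.2) _ ?_
  refine Metric.nhds_basis_ball.to_hasBasis (fun ε hε ↦ ⟨⟨ε, hε⟩, trivial, ?_⟩)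
    fun ε _ ↦ ⟨ε.1, ε.2, ?_⟩
  all_goals
    intro x hx
    simpa [ballIdeal, Subtype.dist_eq] using hx

theorem isTopologicallyNilpotent_of_not_isUnit {x : integers K} (hx : ¬ IsUnit x) :
    IsTopologicallyNilpotent x := by
  rw [IsTopologicallyNilpotent, tendsto_subtype_rng]
  simpa using tendsto_pow_atTop_nhds_zero_of_norm_lt_one (norm_lt_one_of_not_isUnit hx)

end Integers

/-! ### Evaluation of power series on the open unit disk -/

section Evaluation

variable (K : Type*) [NontriviallyNormedField K] [IsUltrametricDist K] [CompleteSpace K]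

instance isAlgClosed_algCl : IsAlgClosed (AlgCl K) :=
  inferInstanceAs (IsAlgClosed (AlgebraicClosure K))

instance isUltrametricDist_Cp : IsUltrametricDist (Cp K) := IsUltrametricDist.of_normedAlgebra K

/-- The inclusion of the ring of integers of `K` in `ℂ_p`. -/
def integersToCp : integers K →+* Cp K :=
  (algebraMap K (Cp K)).comp (integers K).subtype

variable {K}

theorem integersToCp_apply (x : integers K) : integersToCp K x = algebraMap K (Cp K) x := rfl

theorem norm_integersToCp (x : integers K) : ‖integersToCp K x‖ = ‖(x : K)‖ := by
  rw [integersToCp_apply, norm_algebraMap']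

theorem integersToCp_injective : Function.Injective (integersToCp K) :=
  (algebraMap K (Cp K)).injective.comp Subtype.val_injective

/-- The coefficients already lie in `AlgCl K`, so algebraic closedness of its completion is not
needed. -/
theorem splits_map_integersToCp (P : Polynomial (integers K)) :
    (P.map (integersToCp K)).Splits := by
  have h : integersToCp K = (UniformSpace.Completion.coeRingHom (α := AlgCl K)).comp
      ((algebraMap K (AlgCl K)).comp (integers K).subtype) := rfl
  rw [h, ← Polynomial.map_map]
  exact (IsAlgClosed.splits _).map _

theorem norm_eval_term_le (f : (integers K)⟦X⟧) (z : Cp K) (i : ℕ) :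
    ‖integersToCp K (coeff i f) * z ^ i‖ ≤ ‖z‖ ^ i := by
  rw [norm_mul, norm_pow, norm_integersToCp]
  exact mul_le_of_le_one_left (by positivity) (norm_integers_le_one _)

theorem summable_norm_eval (f : (integers K)⟦X⟧) {z : Cp K} (hz : ‖z‖ < 1) :
    Summable fun i ↦ ‖integersToCp K (coeff i f) * z ^ i‖ :=
  .of_nonneg_of_le (fun _ ↦ norm_nonneg _) (norm_eval_term_le f z)
    (summable_geometric_of_lt_one (norm_nonneg _) hz)

theorem eval_eq_tsum (f : (integers K)⟦X⟧) (z : Cp K) :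
    eval f z = ∑' i, integersToCp K (coeff i f) * z ^ i := rfl

theorem eval_add (f g : (integers K)⟦X⟧) {z : Cp K} (hz : ‖z‖ < 1) :
    eval (f + g) z = eval f z + eval g z := by
  simp only [eval_eq_tsum]
  rw [← (summable_norm_eval f hz).of_norm.tsum_add (summable_norm_eval g hz).of_norm]
  simp [add_mul]

theorem eval_mul (f g : (integers K)⟦X⟧) {z : Cp K} (hz : ‖z‖ < 1) :
    eval (f * g) z = eval f z * eval g z := by
  simp only [eval_eq_tsum]
  rw [tsum_mul_tsum_eq_tsum_sum_antidiagonal_of_summable_norm (summable_norm_eval f hz)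
    (summable_norm_eval g hz)]
  refine tsum_congr fun i ↦ ?_
  rw [coeff_mul, map_sum, Finset.sum_mul]
  refine Finset.sum_congr rfl fun x hx ↦ ?_
  rw [← Finset.HasAntidiagonal.mem_antidiagonal.1 hx, pow_add, map_mul]
  ring

theorem eval_coe (P : Polynomial (integers K)) (z : Cp K) :
    eval (P : (integers K)⟦X⟧) z = (P.map (integersToCp K)).eval z := by
  rw [eval_eq_tsum, Polynomial.eval_map, Polynomial.eval₂_eq_sum_range,
    tsum_eq_sum (s := Finset.range (P.natDegree + 1))]
  · simp
  · intro i hi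
    rw [Polynomial.coeff_coe, Polynomial.coeff_eq_zero_of_natDegree_lt (by simpa using hi)]
    simp

theorem eval_ne_zero_of_isUnit {f : (integers K)⟦X⟧} (hf : IsUnit f) {z : Cp K} (hz : ‖z‖ < 1) :
    eval f z ≠ 0 := by
  obtain ⟨g, hg⟩ := hf.exists_right_inv
  have h := eval_mul f g hz
  rw [hg, ← Polynomial.coe_one, eval_coe] at h
  intro h0
  simp [h0] at h

/-- Integral coefficients are bounded, so the expansion at 0 has radius at least 1 and gives
analyticity at every point of the open disk. -/
theorem analyticAt_eval (f : (integers K)⟦X⟧) {z : Cp K} (hz : ‖z‖ < 1) :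
    AnalyticAt (Cp K) (eval f) z := by
  set p := FormalMultilinearSeries.ofScalars (Cp K) fun i ↦ integersToCp K (coeff i f)
  have hr : ((1 : NNReal) : ENNReal) ≤ p.radius := by
    refine p.le_radius_of_bound 1 fun i ↦ ?_
    rw [FormalMultilinearSeries.ofScalars_norm, norm_integersToCp]
    simpa using norm_integers_le_one (coeff i f)
  have hs : p.sum = eval f := by
    ext w
    rw [eval_eq_tsum, ← FormalMultilinearSeries.ofScalarsSum,
      FormalMultilinearSeries.ofScalarsSum_eq_tsum]
    simp
  rw [← hs]
  refine (p.hasFPowerSeriesOnBall (lt_of_lt_of_le (by simp) hr)).analyticAt_of_mem ?_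
  refine Metric.eball_subset_eball hr ?_
  rw [Metric.mem_eball, edist_zero_right, ← ofReal_norm, ENNReal.coe_one,
    ENNReal.ofReal_lt_one]
  exact hz

end Evaluation

/-! ### Order of vanishing of a polynomial -/

theorem analyticOrderAt_polynomial {L : Type*} [NontriviallyNormedField L] {P : Polynomial L}
    (hP : P ≠ 0) (z : L) : analyticOrderAt (fun w ↦ P.eval w) z = P.rootMultiplicity z := by
  obtain ⟨Q, hQ, hdvd⟩ := P.exists_eq_pow_rootMultiplicity_mul_and_not_dvd hP z
  have han (R : Polynomial L) : AnalyticAt L (fun w ↦ R.eval w) z := by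
    simpa using AnalyticAt.aeval_polynomial (analyticAt_id (z := z)) R
  rw [(han P).analyticOrderAt_eq_natCast]
  refine ⟨fun w ↦ Q.eval w, han Q, ?_, .of_forall fun w ↦ ?_⟩
  · rwa [Polynomial.dvd_iff_isRoot] at hdvd
  · conv_lhs => rw [hQ]
    simp

/-! ### The universal power series and their Weierstrass division -/

section Universal

variable (n : ℕ)

/-- The universal power series `∑ Fᵢ Xⁱ`. -/
def univF : (UnivRing n)⟦X⟧ :=
  PowerSeries.mk fun i ↦ if h : i < n then (MvPowerSeries.X ⟨i, h⟩ : UnivRing n) else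
    MvPowerSeries.C (algebraMap (MvPolynomial (Vars n) ℤ) (CoeffRing n) (MvPolynomial.X (Sum.inl ⟨i, not_lt.1 h⟩)))

/-- The universal power series `∑ Gᵢ Xⁱ`. -/
def univG : (UnivRing n)⟦X⟧ :=
  PowerSeries.mk fun i ↦
    MvPowerSeries.C (algebraMap (MvPolynomial (Vars n) ℤ) (CoeffRing n) (MvPolynomial.X (Sum.inr i)))

theorem isUnit_coeff_univF : IsUnit (coeff n (univF n)) := by
  simp only [univF, coeff_mk, lt_self_iff_false, dite_false]
  exact (IsLocalization.Away.algebraMap_isUnit _).map MvPowerSeries.C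

theorem coeff_univF_mem {i : ℕ} (hi : i < n) :
    coeff i (univF n) ∈ (Ideal.span (Set.range MvPowerSeries.X) : Ideal (UnivRing n)) := by
  simp only [univF, coeff_mk, hi, dite_true]
  exact Ideal.subset_span ⟨_, rfl⟩

variable {n} in
/-- If `f` has coefficients in `I` below degree `n`, and a unit in degree `n`, then Weierstrass
division by `f` is possible over a ring that is complete for `I`. -/
theorem exists_division {A : Type*} [CommRing A] {I : Ideal A} [IsAdicComplete I A] {f : A⟦X⟧}
    (hlt : ∀ i < n, coeff i f ∈ I) (hu : IsUnit (coeff n f)) (h : A⟦X⟧) :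
    ∃ (q : A⟦X⟧) (r : Polynomial A), r.degree < n ∧ h = f * q + r := by
  -- In the zero ring the reduction of `f` has order `⊤`, not `n`.
  rcases subsingleton_or_nontrivial A with hA | hA
  · exact ⟨0, 0, by simp, Subsingleton.elim _ _⟩
  have hI : I ≠ ⊤ := by
    rintro rfl
    exact not_subsingleton A (IsHausdorff.subsingleton ‹IsAdicComplete ⊤ A›.toIsHausdorff)
  have : Nontrivial (A ⧸ I) := Ideal.Quotient.nontrivial_iff.2 hI
  -- The division criterion asks for a unit at the index given by the order of `f` modulo `I`; this
  -- identifies that index.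
  have horder : (f.map (Ideal.Quotient.mk I)).order = n := by
    rw [order_eq_nat]
    refine ⟨?_, fun i hi ↦ ?_⟩
    · rw [coeff_map]
      exact (hu.map _).ne_zero
    · rw [coeff_map, Ideal.Quotient.eq_zero_iff_mem]
      exact hlt i hi
  have hdiv : f.IsWeierstrassDivisorAt I := by
    rw [IsWeierstrassDivisorAt, horder]
    exact hu
  have H := hdiv.isWeierstrassDivisionAt_div_mod h
  refine ⟨_, _, ?_, H.eq_mul_add⟩
  simpa [horder] using H.degree_lt

theorem exists_universal_division (h : (UnivRing n)⟦X⟧) :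
    ∃ (q : (UnivRing n)⟦X⟧) (r : Polynomial (UnivRing n)), r.degree < n ∧ h = univF n * q + r :=
  exists_division (fun _ ↦ coeff_univF_mem n) (isUnit_coeff_univF n) h

end Universal

/-! ### Specialization of the universal ring -/

theorem specialize_algebraMap {A : Type*} [CommRing A] {n : ℕ} (f g : A⟦X⟧)
    (hu : IsUnit (coeff n f)) (p : MvPolynomial (Vars n) ℤ) :
    specialize f g hu (algebraMap _ _ p) = MvPolynomial.eval₂Hom (Int.castRingHom A)
      (Sum.elim (fun k : {k : ℕ // n ≤ k} => coeff (k : ℕ) f) (fun k : ℕ => coeff k g)) p :=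
  IsLocalization.Away.lift_eq _ (by simpa using hu) _

section Specialization

variable {A : Type*} [CommRing A] [UniformSpace A] [IsUniformAddGroup A]
  [IsTopologicalRing A] [IsLinearTopology A A] [CompleteSpace A] [T2Space A]

/-- A ring homomorphism extends to power series by evaluating the variables at topologically
nilpotent elements. -/
theorem exists_mvPowerSeries_hom {B σ : Type*} [CommRing B] [Fintype σ] (φ : B →+* A) (a : σ → A)
    (ha : ∀ i, IsTopologicallyNilpotent (a i)) :
    ∃ Φ : MvPowerSeries σ B →+* A,
      (∀ R, HasSum (fun d : σ →₀ ℕ ↦ φ (MvPowerSeries.coeff d R) * ∏ i, a i ^ d i) (Φ R)) ∧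
      (∀ b, Φ (MvPowerSeries.C b) = φ b) ∧ ∀ i, Φ (MvPowerSeries.X i) = a i := by
  -- The discrete topology makes `φ` continuous for free.
  let _ : UniformSpace B := ⊥
  have : DiscreteTopology B := ⟨rfl⟩
  have hcont : Continuous φ := continuous_of_discreteTopology
  have heval : MvPowerSeries.HasEval a := ⟨ha, by simp [Filter.cofinite_eq_bot]⟩
  refine ⟨MvPowerSeries.eval₂Hom hcont heval, fun R ↦ ?_, fun b ↦ ?_, fun i ↦ ?_⟩
  all_goals rw [MvPowerSeries.coe_eval₂Hom]
  · convert MvPowerSeries.hasSum_eval₂ hcont heval R using 3 with d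
    rw [Finsupp.prod_fintype _ _ fun _ ↦ pow_zero _]
  · simp
  · simp

/-- Specialization extends to the ring of universal power series as soon as the values of
`F_0, …, F_{n-1}` are topologically nilpotent. -/
theorem exists_specializeHom {n : ℕ} (f g : A⟦X⟧) (hu : IsUnit (coeff n f))
    (hnil : ∀ i < n, IsTopologicallyNilpotent (coeff i f)) :
    ∃ φ : UnivRing n →+* A, (∀ R, HasSum (specializedTerm R f g hu) (φ R)) ∧
      (univF n).map φ = f ∧ (univG n).map φ = g := by
  obtain ⟨φ, hsum, hC, hX⟩ := exists_mvPowerSeries_hom (specialize f g hu)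
    (fun i : Fin n ↦ coeff (i : ℕ) f) fun i ↦ hnil i i.2
  refine ⟨φ, hsum, ?_, ?_⟩
  · ext i
    rw [coeff_map, univF, coeff_mk]
    split_ifs with h
    · rw [hX]
    · rw [hC, specialize_algebraMap]
      simp
  · ext i
    rw [coeff_map, univG, coeff_mk, hC, specialize_algebraMap]
    simp

end Specialization

/-! ### Weierstrass preparation from Weierstrass division -/

section Local

variable {A : Type*} [CommRing A] [IsLocalRing A] {n : ℕ} {f q : A⟦X⟧} {r : Polynomial A}

/-- In degree `i < n` the division reads `r_i = -(f q)_i`, which involves only the non-units `f_0,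
…, f_i`. -/
theorem coeff_mem_maximalIdeal_of_division (hlt : ∀ i < n, ¬ IsUnit (coeff i f))
    (hr : r.degree < n) (h : (X : A⟦X⟧) ^ n = f * q + r) (i : ℕ) :
    r.coeff i ∈ IsLocalRing.maximalIdeal A := by
  rcases lt_or_ge i n with hi | hi
  · have hc := congrArg (coeff i) h
    rw [coeff_X_pow, if_neg hi.ne, map_add, Polynomial.coeff_coe] at hc
    rw [eq_neg_of_add_eq_zero_right hc.symm, neg_mem_iff, coeff_mul]
    refine Ideal.sum_mem _ fun x hx ↦ Ideal.mul_mem_right _ _ (hlt _ ?_)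
    have := Finset.HasAntidiagonal.mem_antidiagonal.1 hx
    omega
  · rw [Polynomial.coeff_eq_zero_of_degree_lt (hr.trans_le (by exact_mod_cast hi))]
    exact zero_mem _

/-- In degree `n` the division reads `1 = ∑ f_j q_{n-j}`. Every term with `j < n` is in the maximal
ideal, so `f_n q_0` is not. -/
theorem isUnit_of_division (hlt : ∀ i < n, ¬ IsUnit (coeff i f))
    (hr : r.degree < n) (h : (X : A⟦X⟧) ^ n = f * q + r) : IsUnit q := by
  rw [isUnit_iff_constantCoeff, ← coeff_zero_eq_constantCoeff_apply]
  by_contra hq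
  have hc := congrArg (coeff n) h
  rw [coeff_X_pow_self, map_add, Polynomial.coeff_coe, Polynomial.coeff_eq_zero_of_degree_lt hr,
    add_zero, coeff_mul] at hc
  refine (IsLocalRing.maximalIdeal.isMaximal A).ne_top ((Ideal.eq_top_iff_one _).2 ?_)
  rw [hc]
  refine Ideal.sum_mem _ fun x hx ↦ ?_
  have hx := Finset.HasAntidiagonal.mem_antidiagonal.1 hx
  rcases lt_or_ge x.1 n with hi | hi
  · exact Ideal.mul_mem_right _ _ (hlt _ hi)
  · refine Ideal.mul_mem_left _ _ ?_
    rw [show x.2 = 0 by omega]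
    exact hq

end Local

/-! ### Roots in the open unit disk -/

section Roots

variable {K : Type*} [NontriviallyNormedField K] [IsUltrametricDist K] [CompleteSpace K]

/-- If `‖z‖ ≥ 1`, each term of `r(z)` has norm less than `‖z‖ ^ n`, hence so does their sum by the
ultrametric inequality. -/
theorem norm_lt_one_of_root {n : ℕ} {r : Polynomial (integers K)}
    (hr : r.degree < n) (hmem : ∀ i, ¬ IsUnit (r.coeff i)) {z : Cp K}
    (hz : z ^ n = (r.map (integersToCp K)).eval z) : ‖z‖ < 1 := by
  by_contra! h
  have hn : r.natDegree < n ∨ r = 0 := by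
    rcases eq_or_ne r 0 with h0 | h0
    · exact .inr h0
    · exact .inl ((Polynomial.natDegree_lt_iff_degree_lt h0).2 hr)
  have hlt : ‖(r.map (integersToCp K)).eval z‖ < ‖z‖ ^ n := by
    have hpos : 0 < ‖z‖ ^ n := by positivity
    rcases hn with hn | rfl
    · rw [Polynomial.eval_map, Polynomial.eval₂_eq_sum_range]
      obtain ⟨i, hi, hle⟩ := IsUltrametricDist.exists_norm_finsetSum_le_of_nonempty
        (t := Finset.range (r.natDegree + 1)) (by simp)
        (fun i ↦ integersToCp K (r.coeff i) * z ^ i)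
      refine hle.trans_lt ?_
      rw [norm_mul, norm_pow, norm_integersToCp]
      have hi : i ≤ n := by
        have := Finset.mem_range.1 hi
        omega
      calc _ < 1 * ‖z‖ ^ i := by
            gcongr
            exact norm_lt_one_of_not_isUnit (hmem i)
        _ ≤ ‖z‖ ^ n := by simpa using pow_le_pow_right₀ h hi
    · simpa using hpos
  rw [← hz, norm_pow] at hlt
  exact hlt.false

variable {f u : (integers K)⟦X⟧} {P : Polynomial (integers K)}

theorem diskRoots_eq (hP : P.Monic) (hu : IsUnit u) (h : (P : (integers K)⟦X⟧) = f * u)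
    (hroots : ∀ z : Cp K, (P.map (integersToCp K)).eval z = 0 → ‖z‖ < 1) :
    diskRoots f = {z | z ∈ (P.map (integersToCp K)).roots} := by
  ext z
  simp only [diskRoots, Set.mem_ofPred_eq, Polynomial.mem_roots (hP.map _).ne_zero,
    Polynomial.IsRoot.def]
  constructor
  · rintro ⟨hz, hfz⟩
    rw [← eval_coe, h, eval_mul _ _ hz, hfz, zero_mul]
  · intro hz
    have hz1 := hroots z hz
    rw [← eval_coe, h, eval_mul _ _ hz1] at hz
    exact ⟨hz1, (mul_eq_zero.1 hz).resolve_right (eval_ne_zero_of_isUnit hu hz1)⟩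

/-- The order of vanishing is additive on products, and `u` contributes zero because it has no root
in the disk. -/
theorem rootMult_eq (hP : P.Monic) (hu : IsUnit u) (h : (P : (integers K)⟦X⟧) = f * u)
    {z : Cp K} (hz : ‖z‖ < 1) :
    rootMult f z = (P.map (integersToCp K)).rootMultiplicity z := by
  have hev : (fun w ↦ (P.map (integersToCp K)).eval w) =ᶠ[nhds z] eval f * eval u := by
    filter_upwards [Metric.isOpen_ball.mem_nhds (show z ∈ Metric.ball (0 : Cp K) 1 by simpa)]
      with w hw
    rw [← eval_coe, h, eval_mul _ _ (by simpa using hw), Pi.mul_apply]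
  have hord := analyticOrderAt_polynomial (hP.map (integersToCp K)).ne_zero z
  rw [analyticOrderAt_congr hev, analyticOrderAt_mul (analyticAt_eval f hz) (analyticAt_eval u hz),
    (analyticAt_eval u hz).analyticOrderAt_eq_zero.2 (eval_ne_zero_of_isUnit hu hz),
    add_zero] at hord
  rw [rootMult, analyticOrderNatAt, hord, ENat.toNat_natCast]

end Roots

theorem not_isUnit_coeff_of_lt_wideg {A : Type*} [CommRing A] {f : A⟦X⟧} {n i : ℕ}
    (h : wideg f = n) (hi : i < n) : ¬ IsUnit (coeff i f) := fun hu ↦ by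
  have hle : wideg f ≤ i := sInf_le ⟨i, rfl, hu⟩
  rw [h, Nat.cast_le] at hle
  omega

/-! ### The product over the roots as a resultant -/

section Resultant

variable {K : Type*} [NontriviallyNormedField K] [IsUltrametricDist K] [CompleteSpace K]
  {n : ℕ} {f g q q' : (integers K)⟦X⟧} {r s : Polynomial (integers K)}

/-- Over a complete field, the product of the values of `g` at the roots of `f` in the open unit
disk is the resultant of the Weierstrass polynomial of `f` and of the remainder of `g` modulo
`f`. -/
theorem finprod_eval_eq_resultant (hlt : ∀ i < n, ¬ IsUnit (coeff i f))
    (hr : r.degree < n) (hq : (X : (integers K)⟦X⟧) ^ n = f * q + r)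
    (hs : s.degree < n) (hq' : g = f * q' + s) :
    (diskRoots f).Finite ∧
      ∏ᶠ z ∈ diskRoots f, eval g z ^ rootMult f z =
        integersToCp K ((Polynomial.X ^ n - r).resultant s n n) ∧
      ∀ z ∈ diskRoots f, rootMult f z ≠ 0 := by
  classical
  set P : Polynomial (integers K) := Polynomial.X ^ n - r with hPdef
  have hP : P.Monic := Polynomial.monic_X_pow_sub hr
  have hdeg : P.natDegree = n := Polynomial.natDegree_eq_of_degree_eq_some <| by
    rw [hPdef, Polynomial.degree_sub_eq_left_of_degree_lt (by simpa using hr),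
      Polynomial.degree_X_pow]
  have hu : IsUnit q := isUnit_of_division hlt hr hq
  have hfac : (P : (integers K)⟦X⟧) = f * q := by
    rw [hPdef, Polynomial.coe_sub, Polynomial.coe_pow, Polynomial.coe_X, hq, add_sub_cancel_right]
  have hroots (z : Cp K) (hz : (P.map (integersToCp K)).eval z = 0) : ‖z‖ < 1 := by
    refine norm_lt_one_of_root hr (coeff_mem_maximalIdeal_of_division hlt hr hq) ?_
    rwa [hPdef, Polynomial.map_sub, Polynomial.map_pow, Polynomial.map_X, Polynomial.eval_sub,
      Polynomial.eval_pow, Polynomial.eval_X, sub_eq_zero] at hz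
  have hdisk : diskRoots f = (P.map (integersToCp K)).roots.toFinset := by
    rw [diskRoots_eq hP hu hfac hroots]
    ext z
    simp
  refine ⟨hdisk ▸ Finset.finite_toSet _, ?_, fun z hz ↦ ?_⟩
  · have hres := Polynomial.resultant_eq_prod_eval (P.map (integersToCp K))
      (s.map (integersToCp K)) n
      (Polynomial.natDegree_le_of_degree_le (Polynomial.degree_map_le.trans hs.le))
      (splits_map_integersToCp P)
    rw [hP.natDegree_map, hdeg, Polynomial.resultant_map_map, (hP.map _).leadingCoeff, one_pow,
      one_mul] at hres
    rw [hres, hdisk, finprod_mem_coe_finset, Finset.prod_multiset_map_count]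
    refine Finset.prod_congr rfl fun z hz ↦ ?_
    have hzd : z ∈ diskRoots f := hdisk ▸ hz
    rw [rootMult_eq hP hu hfac hzd.1, Polynomial.count_roots, hq', eval_add _ _ hzd.1,
      eval_mul _ _ hzd.1, hzd.2, zero_mul, zero_add, eval_coe]
  · rw [rootMult_eq hP hu hfac hz.1, ← Polynomial.count_roots, Multiset.count_ne_zero]
    have hz' := hdisk ▸ hz
    simpa using hz'

end Resultant

end PadicResultant

end

theorem theoremA (n : ℕ) (hn : 1 ≤ n) :
    ∃ Res : PadicResultant.UnivRing n,
      ∀ (p : ℕ) [Fact p.Prime] (K : Type*) [NontriviallyNormedField K] [IsUltrametricDist K]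
        [CompleteSpace K] [PadicResultant.IsPadicField p K]
        (f g : PowerSeries (PadicResultant.integers K)) (hf : PadicResultant.wideg f = n),
        (PadicResultant.diskRoots f).Finite ∧
        ∃ r : PadicResultant.integers K,
          HasSum (PadicResultant.specializedTerm Res f g
            (PadicResultant.isUnit_coeff_of_wideg hf)) r ∧
          ∏ᶠ z ∈ PadicResultant.diskRoots f,
              PadicResultant.eval g z ^ PadicResultant.rootMult f z =
            algebraMap K (PadicResultant.Cp K) (r : K) ∧
          (r = 0 ↔ ∃ z : PadicResultant.Cp K,
            ‖z‖ < 1 ∧ PadicResultant.eval f z = 0 ∧ PadicResultant.eval g z = 0) := by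
  obtain ⟨q, r, hr, hq⟩ := PadicResultant.exists_universal_division n (PowerSeries.X ^ n)
  obtain ⟨q', s, hs, hq'⟩ := PadicResultant.exists_universal_division n (PadicResultant.univG n)
  refine ⟨(Polynomial.X ^ n - r).resultant s n n, ?_⟩
  intro p _ K _ _ _ _ f g hf
  have hlt (i : ℕ) (hi : i < n) : ¬ IsUnit (PowerSeries.coeff i f) :=
    PadicResultant.not_isUnit_coeff_of_lt_wideg hf hi
  obtain ⟨φ, hsum, hφf, hφg⟩ := PadicResultant.exists_specializeHom f g
    (PadicResultant.isUnit_coeff_of_wideg hf)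
    fun i hi ↦ PadicResultant.isTopologicallyNilpotent_of_not_isUnit (hlt i hi)
  have hqφ := congrArg (PowerSeries.map φ) hq
  have hqφ' := congrArg (PowerSeries.map φ) hq'
  rw [map_pow, PowerSeries.map_X, map_add, map_mul, hφf, ← Polynomial.polynomial_map_coe] at hqφ
  rw [map_add, map_mul, hφf, hφg, ← Polynomial.polynomial_map_coe] at hqφ'
  obtain ⟨hfin, hprod, hmult⟩ := PadicResultant.finprod_eval_eq_resultant hlt
    (Polynomial.degree_map_le.trans_lt hr) hqφ (Polynomial.degree_map_le.trans_lt hs) hqφ'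
  -- The formal degrees are fixed at `n`, so the resultant commutes with `φ` even if the degree of
  -- `s` drops.
  have hres : ((Polynomial.X ^ n - r.map φ).resultant (s.map φ) n n) =
      φ ((Polynomial.X ^ n - r).resultant s n n) := by
    rw [← Polynomial.resultant_map_map, Polynomial.map_sub, Polynomial.map_pow, Polynomial.map_X]
  rw [hres] at hprod
  refine ⟨hfin, _, hsum _, hprod, ?_⟩
  rw [← map_eq_zero_iff _ PadicResultant.integersToCp_injective, ← hprod,
    finprod_mem_eq_finite_toFinset_prod _ hfin, Finset.prod_eq_zero_iff]
  constructor
  · rintro ⟨z, hz, h0⟩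
    have hz : z ∈ PadicResultant.diskRoots f := hfin.mem_toFinset.1 hz
    exact ⟨z, hz.1, hz.2, eq_zero_of_pow_eq_zero h0⟩
  · rintro ⟨z, hz, hfz, hgz⟩
    -- The multiplicity must be nonzero here, since `0 ^ 0 = 1`.
    exact ⟨z, hfin.mem_toFinset.2 ⟨hz, hfz⟩, by rw [hgz, zero_pow (hmult z ⟨hz, hfz⟩)]⟩
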